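/- **Setting.** Let $n\ge 1$ and let $\bar A\in[0,1]^{n\times n}$ be symmetric. A random graph $A\sim\bar A$ is an undirected graph on $n$ vertices with (symmetric, $0/1$) adjacency matrix $A$ in which, for each pair $i\le j$, the edge $\{i,j\}$ is present with probability $\bar A_{ij}$, independently over the pairs (self-loops are excluded by setting $\bar A_{ii}=0$). Eigenvalues of a symmetric matrix are listed in decreasing (signed) order $\lambda_1\ge\lambda_2\ge\dots\ge\lambda_n$; $v_1(\bar A)$ is an eigenvector of $\bar A$ for $\lambda_1(\bar A)$ with Euclidean norm $1$. The inverted spectral gap of $\bar A$ is the smallest $\kappa\ge 0$ with $|\lambda_i(\bar A)|\le\kappa\,\lambda_1(\bar A)$ for all $i>1$. Let $d_{\max}=\max_i\sum_j\bar A_{ij}$. For $\varepsilon,\delta\in(0,1)$, $\bar A$ satisfies *$(\varepsilon,\delta)$-concentration* if $d_{\max}\ge\frac49\log(2n/\delta)$ and, for some real $\kappa$, the inverted spectral gap of $\bar A$ is at most $\kappa$ and $$\lambda_1(\bar A)\,(1-\kappa^2)\ \ge\ \frac{1024\sqrt{d_{\max}\log(2n/\delta)}}{\varepsilon^2}.$$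 Let $\beta>0$ and $b\in\mathbb R^n$ with $b_i\ge 0$ for all $i$. In the linear-quadratic network game on $A$ with standalone marginal values $\hat b\in\mathbb R^n$, agent $i$ has utility $u_i(a)=\hat b_ia_i-\frac12a_i^2+\beta\sum_jA_{ij}a_ia_j$; the best response to a current profile $a$ is $\hat b+\beta Aa$ (in a self-loop term the current action is held fixed), so the equilibrium is $a^*=(I-\beta A)^{-1}\hat b$ when $I-\beta A$ is invertible. For an intervention $y\in\mathbb R^n$, let $W(y)=\sum_iu_i(a^*)$ be the social welfare at equilibrium with $\hat b=b+y$. The competitive ratio of $y$ at budget $C$ is $W(y)/W(y^*)$, where $y^*$ maximizes $W$ over $\{x:\|x\|_2=\sqrt C\}$. **Theorem.** Suppose that $\bar A$ satisfies $(\varepsilon,\delta)$-concentration. Then for all $\beta>0$ and $b\ge 0$ there is a budget $C_0$ (not depending on the sampled graph) such that with probability at least $1-\delta$ over $A\sim\bar A$ the following holds: if the spectral radius of $A$ is less than $1/\beta$, then for every $C\ge C_0$ the intervention $y=\sqrt C\,v_1(\bar A)$ has competitive ratio at least $1-\varepsilon$. -/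

import Mathlib

open MeasureTheory ProbabilityTheory Matrix

noncomputable section

namespace NetworkGame

variable {n : ℕ}

/-- A matrix of edge probabilities: symmetric, with entries in `[0,1]`
(the diagonal holds the probabilities of self-loops and may be zero). -/
structure IsEdgeProbMatrix (Abar : Matrix (Fin n) (Fin n) ℝ) : Prop where
  symm : Abar.IsSymm
  nonneg : ∀ i j, 0 ≤ Abar i j
  le_one : ∀ i j, Abar i j ≤ 1

/-- `A` is the adjacency matrix of a random undirected graph with independent edges: each
edge `{i,j}` (`i ≤ j`) is present with probability `Abar i j`, independently of the others. -/
structure IsSampledFrom {Ω : Type*} [MeasurableSpace Ω] (P : Measure Ω)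
    (A : Ω → Matrix (Fin n) (Fin n) ℝ) (Abar : Matrix (Fin n) (Fin n) ℝ) : Prop where
  symm : ∀ ω, (A ω).IsSymm
  zero_or_one : ∀ ω i j, A ω i j = 0 ∨ A ω i j = 1
  measurable : ∀ i j, Measurable fun ω => A ω i j
  prob_edge : ∀ i j, P {ω | A ω i j = 1} = ENNReal.ofReal (Abar i j)
  indep : iIndepFun
    (fun (e : {e : Fin n × Fin n // e.1 ≤ e.2}) (ω : Ω) => A ω e.1.1 e.1.2) P

theorem isHermitian_of_isSymm {A : Matrix (Fin n) (Fin n) ℝ} (hA : A.IsSymm) :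
    A.IsHermitian := by
  rw [Matrix.IsHermitian, Matrix.conjTranspose_eq_transpose_of_trivial]
  exact hA

/-- The eigenvalues of a real symmetric matrix in decreasing order, with multiplicity;
index `0` is the largest one (signed, not in absolute value). -/
def eigenvalue (A : Matrix (Fin n) (Fin n) ℝ) (hA : A.IsSymm) (i : Fin n) : ℝ :=
  (isHermitian_of_isSymm hA).eigenvalues₀ (Fin.cast (Fintype.card_fin n).symm i)

/-- `v` is a unit (Euclidean norm) eigenvector for the largest eigenvalue. -/
structure IsFirstEigenvector [NeZero n] (A : Matrix (Fin n) (Fin n) ℝ) (hA : A.IsSymm)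
    (v : EuclideanSpace ℝ (Fin n)) : Prop where
  norm_eq_one : ‖v‖ = 1
  mulVec_eq : A *ᵥ v.ofLp = eigenvalue A hA 0 • v.ofLp

/-- The inverted spectral gap: the smallest `κ ≥ 0` such that `|λ_i| ≤ κ λ_1` for all `i > 1`. -/
def invertedSpectralGap [NeZero n] (A : Matrix (Fin n) (Fin n) ℝ) (hA : A.IsSymm) : ℝ :=
  sInf {κ : ℝ | 0 ≤ κ ∧ ∀ i : Fin n, i ≠ 0 → |eigenvalue A hA i| ≤ κ * eigenvalue A hA 0}

/-- The largest expected degree. -/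
def dMax (Abar : Matrix (Fin n) (Fin n) ℝ) : ℝ := ⨆ i, ∑ j, Abar i j

/-- `(ε,δ)`-concentration. -/
def Concentration [NeZero n] (Abar : Matrix (Fin n) (Fin n) ℝ) (hA : Abar.IsSymm)
    (ε δ : ℝ) : Prop :=
  0 < ε ∧ ε < 1 ∧ 0 < δ ∧ δ < 1 ∧
  4 / 9 * Real.log (2 * n / δ) ≤ dMax Abar ∧
  ∃ κ : ℝ, invertedSpectralGap Abar hA ≤ κ ∧
    1024 * √(dMax Abar * Real.log (2 * n / δ)) / ε ^ 2 ≤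
      eigenvalue Abar hA 0 * (1 - κ ^ 2)

/-- The utility of agent `i` with standalone marginal values `b` from the action `x` against the
current action profile `a`: `b_i x - x²/2 + β ∑_j A_ij x a_j`. If there is a self-loop at `i`,
the corresponding term of the sum uses the current action `a i`. -/
def utilityOf (A : Matrix (Fin n) (Fin n) ℝ) (β : ℝ) (b a : Fin n → ℝ) (i : Fin n) (x : ℝ) : ℝ :=
  b i * x - 1 / 2 * x ^ 2 + β * ∑ j, A i j * x * a j

/-- The utility `u_i(a, A) = b_i a_i - a_i²/2 + β ∑_j A_ij a_i a_j`. -/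
def utility (A : Matrix (Fin n) (Fin n) ℝ) (β : ℝ) (b a : Fin n → ℝ) (i : Fin n) : ℝ :=
  utilityOf A β b a i (a i)

/-- All agents are simultaneously best responding. -/
def IsEquilibrium (A : Matrix (Fin n) (Fin n) ℝ) (β : ℝ) (b a : Fin n → ℝ) : Prop :=
  ∀ i x, utilityOf A β b a i x ≤ utility A β b a i

/-- The equilibrium actions `(I - β A)⁻¹ b` (meaningful when `I - β A` is invertible). -/
def equilibrium (A : Matrix (Fin n) (Fin n) ℝ) (β : ℝ) (b : Fin n → ℝ) : Fin n → ℝ :=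
  (1 - β • A)⁻¹ *ᵥ b

/-- Being an equilibrium amounts to the best-response equation `a = b + β A a`. -/
theorem isEquilibrium_iff (A : Matrix (Fin n) (Fin n) ℝ) (β : ℝ) (b a : Fin n → ℝ) :
    IsEquilibrium A β b a ↔ a = b + β • (A *ᵥ a) := by
  have key : ∀ i x, utility A β b a i - utilityOf A β b a i x =
      (a i - x) * ((b + β • (A *ᵥ a)) i - a i) + 1 / 2 * (a i - x) ^ 2 := by
    intro i x
    have h : ∀ x, ∑ j, A i j * x * a j = x * (A *ᵥ a) i := by
      intro x
      simp only [Matrix.mulVec, dotProduct, Finset.mul_sum]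
      exact Finset.sum_congr rfl fun j _ => by ring
    simp only [utility, utilityOf, h, Pi.add_apply, Pi.smul_apply, smul_eq_mul]
    ring
  constructor
  · intro h
    funext i
    have h1 := h i ((b + β • (A *ᵥ a)) i)
    have h2 := key i ((b + β • (A *ᵥ a)) i)
    nlinarith [sq_nonneg (a i - (b + β • (A *ᵥ a)) i)]
  · intro h i x
    have h2 := key i x
    rw [← h] at h2
    nlinarith [sq_nonneg (a i - x)]

/-- When `I - β A` is invertible, `equilibrium` is the unique equilibrium. -/
theorem isEquilibrium_iff_eq (A : Matrix (Fin n) (Fin n) ℝ) (β : ℝ) (b a : Fin n → ℝ)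
    (hM : IsUnit (1 - β • A).det) : IsEquilibrium A β b a ↔ a = equilibrium A β b := by
  rw [isEquilibrium_iff, equilibrium]
  have hMa : (1 - β • A) *ᵥ a = a - β • (A *ᵥ a) := by
    rw [Matrix.sub_mulVec, Matrix.one_mulVec, Matrix.smul_mulVec]
  constructor
  · intro h
    have : b = (1 - β • A) *ᵥ a := by rw [hMa]; exact (sub_eq_of_eq_add h).symm
    rw [this, Matrix.mulVec_mulVec, Matrix.nonsing_inv_mul _ hM, Matrix.one_mulVec]
  · intro h
    have : (1 - β • A) *ᵥ a = b := by
      rw [h, Matrix.mulVec_mulVec, Matrix.mul_nonsing_inv _ hM, Matrix.one_mulVec]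
    rw [hMa] at this
    exact sub_eq_iff_eq_add.mp this

/-- The social welfare `W(y)`: the sum of the utilities at the equilibrium that is reached when
the intervention `y` changes the standalone marginal values from `b` to `b + y`. -/
def welfare (A : Matrix (Fin n) (Fin n) ℝ) (β : ℝ) (b y : EuclideanSpace ℝ (Fin n)) : ℝ :=
  ∑ i, utility A β (b + y).ofLp (equilibrium A β (b + y).ofLp) i

/-- At equilibrium, social welfare is half the squared norm of the action vector. -/
theorem welfare_eq (A : Matrix (Fin n) (Fin n) ℝ) (β : ℝ) (b y : EuclideanSpace ℝ (Fin n))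
    (hM : IsUnit (1 - β • A).det) :
    welfare A β b y =
      1 / 2 * (equilibrium A β (b + y).ofLp ⬝ᵥ equilibrium A β (b + y).ofLp) := by
  have h := (isEquilibrium_iff A β (b + y).ofLp _).1
    ((isEquilibrium_iff_eq A β (b + y).ofLp _ hM).2 rfl)
  rw [welfare]
  generalize equilibrium A β (b + y).ofLp = a at h ⊢
  rw [dotProduct, Finset.mul_sum]
  refine Finset.sum_congr rfl fun i _ => ?_
  have hs : ∑ j, A i j * a i * a j = a i * (A *ᵥ a) i := by
    simp only [Matrix.mulVec, dotProduct, Finset.mul_sum]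
    exact Finset.sum_congr rfl fun j _ => by ring
  have hi := congrFun h i
  simp only [Pi.add_apply, Pi.smul_apply, smul_eq_mul] at hi
  simp only [utility, utilityOf, hs]
  linear_combination (-a i) * hi

/-- `ystar` maximizes the welfare among interventions `x` with `‖x‖ = √C`. -/
structure IsOptimalIntervention (A : Matrix (Fin n) (Fin n) ℝ) (β : ℝ)
    (b : EuclideanSpace ℝ (Fin n)) (C : ℝ) (ystar : EuclideanSpace ℝ (Fin n)) : Prop where
  norm_eq : ‖ystar‖ = √C
  le_welfare : ∀ x : EuclideanSpace ℝ (Fin n), ‖x‖ = √C → welfare A β b x ≤ welfare A β b ystar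

/-- The competitive ratio `W(y) / W(y*)` is at least `r`, where `y*` is an optimal intervention
of budget `C` (which is part of the assertion); `W(y*)` does not depend on the choice of `y*`. -/
def CompetitiveRatioAtLeast (A : Matrix (Fin n) (Fin n) ℝ) (β : ℝ)
    (b : EuclideanSpace ℝ (Fin n)) (C : ℝ) (y : EuclideanSpace ℝ (Fin n)) (r : ℝ) : Prop :=
  ∃ ystar, IsOptimalIntervention A β b C ystar ∧ r ≤ welfare A β b y / welfare A β b ystar

end NetworkGame

end

/-! In an orthonormal eigenbasis of `A`, equilibrium welfare is half the sum of the squared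
coordinates of `b + y` with weights `(1 - β λ_i)⁻²`, the largest weight belonging to the top
eigenvector `u` of `A` (`welfare_conj_diagonal`). Once `‖b‖` is small against `√C`, an intervention
is therefore nearly optimal as soon as it is well aligned with `u`
(`competitiveRatioAtLeast_of_correlation`).

Alignment of `v₁(Abar)` with `u` follows from a gap argument (`gap_mul_one_sub_sq_le`): if the
quadratic forms of `A` and `Abar` differ by at most `M` on unit vectors, then `(1 - κ) λ₁ (1 - ⟨u,
v₁⟩²) ≤ 2 M`.

The bound `M = 5/2 √(dMax log(2n/δ))` holds with probability at least `1 - δ` by a matrix Bernstein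
inequality (`one_sub_le_measureReal_quadratic_form`). It is proved by the Laplace transform: the
Golden–Thompson inequality splits off one edge at a time, and subtracting a variance term from each
exponent keeps the expected trace of the exponential at most `n`. -/

noncomputable section

namespace NetworkGame

/-! ### The Golden–Thompson inequality. -/

section GoldenThompson

/-- Expand the squared Frobenius norm of `X - Yᵀ`, which is nonnegative. -/
theorem trace_mul_le_half_add {m : Type*} [Fintype m] (X Y : Matrix m m ℝ) :
    (X * Y).trace ≤ ((X * Xᵀ).trace + (Y * Yᵀ).trace) / 2 := by
  have h : 0 ≤ ((X - Yᵀ) * (X - Yᵀ)ᵀ).trace := by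
    have := (Matrix.posSemidef_self_mul_conjTranspose (X - Yᵀ)).trace_nonneg
    rwa [conjTranspose_eq_transpose_of_trivial] at this
  have h1 : (Yᵀ * Xᵀ).trace = (X * Y).trace := by
    rw [← transpose_mul, trace_transpose]
  have h2 : (Yᵀ * Y).trace = (Y * Yᵀ).trace := trace_mul_comm _ _
  simp only [transpose_sub, transpose_transpose, mul_sub, sub_mul, trace_sub] at h
  linarith

variable {m : Type*} [Fintype m] [DecidableEq m]

theorem trace_mul_pow_comm (X Y : Matrix m m ℝ) (k : ℕ) :
    ((X * Y) ^ k).trace = ((Y * X) ^ k).trace := by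
  cases k with
  | zero => simp
  | succ k =>
    have h : (X * Y) ^ (k + 1) = X * ((Y * X) ^ k * Y) := by
      rw [pow_succ', mul_assoc]
      congr 1
      have : SemiconjBy Y (X * Y) (Y * X) := by simp [SemiconjBy, mul_assoc]
      exact (this.pow_right k).eq
    rw [h, trace_mul_comm, mul_assoc, ← pow_succ]

/-- Two trace inequalities, which are proved by a joint induction. -/
theorem trace_pow_two_pow_le (k : ℕ) :
    (∀ M : Matrix m m ℝ, (M ^ 2 ^ (k + 1)).trace ≤ ((M * Mᵀ) ^ 2 ^ k).trace) ∧
    (∀ P Q : Matrix m m ℝ, P.IsSymm → Q.IsSymm →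
      ((P * Q) ^ 2 ^ k).trace ≤ (P ^ 2 ^ k * Q ^ 2 ^ k).trace) := by
  induction k with
  | zero =>
    refine ⟨fun M => ?_, fun P Q _ _ => by simp⟩
    have := trace_mul_le_half_add M M
    simpa [pow_two] using this
  | succ k ih =>
    obtain ⟨ih1, ih2⟩ := ih
    constructor
    · intro M
      -- Apply `ih1` to `M * M`. Cyclicity turns the result into a power of `(M Mᵀ)(Mᵀ M)`, `ih2`
      -- separates the two factors, and the arithmetic–geometric mean bound merges them again, since
      -- both have the same trace powers.
      have e1 : M ^ 2 ^ (k + 1 + 1) = (M * M) ^ 2 ^ (k + 1) := by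
        rw [← pow_two, ← pow_mul]; congr 1; ring
      have h1 := ih1 (M * M)
      have e2 : M * M * (M * M)ᵀ = M * (M * Mᵀ * Mᵀ) := by
        simp only [transpose_mul, mul_assoc]
      rw [e2, trace_mul_pow_comm M (M * Mᵀ * Mᵀ)] at h1
      have e3 : M * Mᵀ * Mᵀ * M = (M * Mᵀ) * (Mᵀ * M) := by simp only [mul_assoc]
      rw [e3] at h1
      have s1 : (M * Mᵀ).IsSymm := by simp [IsSymm, transpose_mul]
      have s2 : (Mᵀ * M).IsSymm := by simp [IsSymm, transpose_mul]
      have h2 := ih2 _ _ s1 s2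
      have h3 := trace_mul_le_half_add ((M * Mᵀ) ^ 2 ^ k) ((Mᵀ * M) ^ 2 ^ k)
      rw [(s1.pow _).eq, (s2.pow _).eq, ← pow_add, ← pow_add, ← two_mul, ← pow_succ',
        trace_mul_pow_comm Mᵀ M] at h3
      rw [e1]
      linarith
    · intro P Q hP hQ
      -- Up to cyclicity `(P Q)(P Q)ᵀ` is `Q² P²`, so `ih2` applies to the squares.
      have h1 := ih1 (P * Q)
      have e2 : P * Q * (P * Q)ᵀ = P * (Q * Q * P) := by
        rw [transpose_mul, hP.eq, hQ.eq]; simp only [mul_assoc]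
      rw [e2, trace_mul_pow_comm P (Q * Q * P)] at h1
      have e3 : Q * Q * P * P = (Q ^ 2) * (P ^ 2) := by simp only [mul_assoc, pow_two]
      rw [e3] at h1
      have h2 := ih2 _ _ (hQ.pow 2) (hP.pow 2)
      rw [← pow_mul, ← pow_mul, ← pow_succ', trace_mul_comm] at h2
      linarith

theorem norm_exp_le_exp_norm {𝔸 : Type*} [NormedRing 𝔸] [NormedAlgebra ℝ 𝔸] [NormOneClass 𝔸]
    (x : 𝔸) : ‖NormedSpace.exp x‖ ≤ Real.exp ‖x‖ := by
  have h : HasSum (fun k : ℕ => ((k.factorial : ℝ)⁻¹ • ‖x‖ ^ k : ℝ)) (Real.exp ‖x‖) := by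
    rw [Real.exp_eq_exp_ℝ]
    exact NormedSpace.exp_series_hasSum_exp' ‖x‖
  rw [NormedSpace.exp_eq_tsum ℝ]
  refine tsum_of_norm_bounded h fun k => ?_
  rw [norm_smul, norm_inv, Real.norm_natCast, smul_eq_mul]
  gcongr
  exact norm_pow_le x k

/-- Telescoping. The exponent `N` in place of `N - 1` is affordable because `1 ≤ K`. -/
theorem norm_pow_sub_pow_le {𝔸 : Type*} [NormedRing 𝔸] [NormOneClass 𝔸] {X Y : 𝔸} {K : ℝ}
    (hK : 1 ≤ K) (hX : ‖X‖ ≤ K) (hY : ‖Y‖ ≤ K) (N : ℕ) :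
    ‖X ^ N - Y ^ N‖ ≤ N * K ^ N * ‖X - Y‖ := by
  induction N with
  | zero => simp
  | succ N ih =>
    have e : X ^ (N + 1) - Y ^ (N + 1) = X ^ N * (X - Y) + (X ^ N - Y ^ N) * Y := by
      rw [pow_succ, pow_succ]; noncomm_ring
    have h1 : ‖X ^ N * (X - Y)‖ ≤ K ^ (N + 1) * ‖X - Y‖ := by
      refine (norm_mul_le _ _).trans (mul_le_mul_of_nonneg_right ?_ (norm_nonneg _))
      exact ((norm_pow_le X N).trans (pow_le_pow_left₀ (norm_nonneg _) hX N)).trans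
        (pow_le_pow_right₀ hK N.le_succ)
    have h2 : ‖(X ^ N - Y ^ N) * Y‖ ≤ N * K ^ N * ‖X - Y‖ * K :=
      (norm_mul_le _ _).trans (mul_le_mul ih hY (norm_nonneg _) (by positivity))
    rw [e]
    refine (norm_add_le _ _).trans ((add_le_add h1 h2).trans_eq ?_)
    push_cast
    ring

/-- The Lie product formula along powers of two. -/
theorem tendsto_exp_mul_exp_pow {𝔸 : Type*} [NormedRing 𝔸] [NormedAlgebra ℝ 𝔸] [CompleteSpace 𝔸]
    [NormOneClass 𝔸] (A B : 𝔸) :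
    Filter.Tendsto (fun k : ℕ => (NormedSpace.exp ((2 ^ k : ℝ)⁻¹ • A) *
      NormedSpace.exp ((2 ^ k : ℝ)⁻¹ • B)) ^ 2 ^ k) Filter.atTop
      (nhds (NormedSpace.exp (A + B))) := by
  let _ : NormedAlgebra ℚ 𝔸 := NormedAlgebra.restrictScalars ℚ ℝ 𝔸
  let f : ℝ → 𝔸 := fun t => NormedSpace.exp (t • A) * NormedSpace.exp (t • B) -
    NormedSpace.exp (t • (A + B))
  -- The first-order terms cancel, so `f (1/N) = o(1/N)`. Passing to `N`-th powers costs only a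
  -- factor `N * exp (‖A‖ + ‖B‖)`.
  have hf : HasDerivAt f 0 0 := by
    have h1 := hasDerivAt_exp_smul_const (𝕂 := ℝ) A 0
    have h2 := hasDerivAt_exp_smul_const (𝕂 := ℝ) B 0
    have h3 := hasDerivAt_exp_smul_const (𝕂 := ℝ) (A + B) 0
    have h := (h1.mul h2).sub h3
    simp only [zero_smul, NormedSpace.exp_zero, one_mul, mul_one, sub_self] at h
    exact h
  have ht0 : Filter.Tendsto (fun k : ℕ => (2 ^ k : ℝ)⁻¹) Filter.atTop (nhds 0) :=
    (tendsto_pow_atTop_atTop_of_one_lt (one_lt_two (α := ℝ))).inv_tendsto_atTop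
  have ht : Filter.Tendsto (fun k : ℕ => (2 ^ k : ℝ)⁻¹) Filter.atTop (nhdsWithin 0 {0}ᶜ) :=
    tendsto_nhdsWithin_iff.2 ⟨ht0, Filter.Eventually.of_forall fun k => by simp⟩
  have hs := ((hasDerivAt_iff_tendsto_slope.1 hf).comp ht).norm.const_mul
    (Real.exp (‖A‖ + ‖B‖))
  rw [norm_zero, mul_zero] at hs
  rw [tendsto_iff_norm_sub_tendsto_zero]
  refine squeeze_zero (fun _ => norm_nonneg _) (fun k => ?_) hs
  set N : ℕ := 2 ^ k with hN
  have hNc : (2 ^ k : ℝ) = N := by simp [hN]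
  have hN0 : (0 : ℝ) < N := by rw [← hNc]; positivity
  rw [Function.comp_apply, hNc]
  have hpow : NormedSpace.exp ((N : ℝ)⁻¹ • (A + B)) ^ N = NormedSpace.exp (A + B) := by
    rw [← NormedSpace.exp_nsmul, ← Nat.cast_smul_eq_nsmul ℝ, smul_smul,
      mul_inv_cancel₀ hN0.ne', one_smul]
  have hb : ∀ x : 𝔸, ‖NormedSpace.exp ((N : ℝ)⁻¹ • x)‖ ≤ Real.exp ((N : ℝ)⁻¹ * ‖x‖) := by
    intro x
    refine (norm_exp_le_exp_norm _).trans_eq ?_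
    rw [norm_smul, norm_inv, Real.norm_natCast]
  have hX : ‖NormedSpace.exp ((N : ℝ)⁻¹ • A) * NormedSpace.exp ((N : ℝ)⁻¹ • B)‖ ≤
      Real.exp ((N : ℝ)⁻¹ * (‖A‖ + ‖B‖)) := by
    rw [mul_add, Real.exp_add]
    exact (norm_mul_le _ _).trans
      (mul_le_mul (hb A) (hb B) (norm_nonneg _) (Real.exp_pos _).le)
  have hY : ‖NormedSpace.exp ((N : ℝ)⁻¹ • (A + B))‖ ≤ Real.exp ((N : ℝ)⁻¹ * (‖A‖ + ‖B‖)) := by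
    refine (hb _).trans (Real.exp_le_exp.2 ?_)
    gcongr
    exact norm_add_le _ _
  have h := norm_pow_sub_pow_le (Real.one_le_exp (by positivity)) hX hY N
  rw [hpow, ← Real.exp_nat_mul, mul_inv_cancel_left₀ hN0.ne'] at h
  refine h.trans_eq ?_
  have hf0 : f 0 = 0 := by simp [f]
  rw [slope_def_module, hf0, sub_zero, sub_zero, inv_inv, norm_smul, Real.norm_natCast]
  simp only [f]
  ring

/-- The Golden–Thompson inequality for real symmetric matrices. -/
theorem trace_exp_add_le (A B : Matrix m m ℝ) (hA : A.IsSymm) (hB : B.IsSymm) :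
    (NormedSpace.exp (A + B)).trace ≤ (NormedSpace.exp A * NormedSpace.exp B).trace := by
  open scoped Matrix.Norms.Operator in
  cases isEmpty_or_nonempty m
  · simp [trace]
  have h := tendsto_exp_mul_exp_pow A B
  have h2 := ((continuous_id (X := Matrix m m ℝ)).matrix_trace.tendsto _).comp h
  refine le_of_tendsto h2 (Filter.Eventually.of_forall fun k => ?_)
  have hs : ∀ A : Matrix m m ℝ, NormedSpace.exp ((2 ^ k : ℝ)⁻¹ • A) ^ 2 ^ k =
      NormedSpace.exp A := by
    intro A
    rw [← Matrix.exp_nsmul, ← Nat.cast_smul_eq_nsmul ℝ, smul_smul]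
    simp
  -- The power `2 ^ k` undoes the scaling of each factor, so the upper bound does not depend on `k`.
  have := (trace_pow_two_pow_le k).2 _ _ (hA.smul ((2 ^ k : ℝ)⁻¹)).exp
    (hB.smul ((2 ^ k : ℝ)⁻¹)).exp
  rw [hs, hs] at this
  exact this

end GoldenThompson

/-! ### Spectral calculus, and the exponential moment of one Bernoulli term. -/

section Spectral

variable {m : Type*} [Fintype m] [DecidableEq m]

theorem dotProduct_conj_diagonal (U : Matrix m m ℝ) (d x : m → ℝ) :
    x ⬝ᵥ (U * diagonal d * Uᵀ) *ᵥ x = ∑ i, d i * (Uᵀ *ᵥ x) i ^ 2 := by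
  rw [← mulVec_mulVec, ← mulVec_mulVec, dotProduct_mulVec, ← mulVec_transpose, dotProduct]
  refine Finset.sum_congr rfl fun i _ => ?_
  rw [mulVec_diagonal]
  ring

theorem posSemidef_conj_diagonal (U : Matrix m m ℝ) {d : m → ℝ} (hd : ∀ i, 0 ≤ d i) :
    (U * diagonal d * Uᵀ).PosSemidef := by
  have := (PosSemidef.diagonal (n := m) (d := d) hd).mul_mul_conjTranspose_same U
  rwa [conjTranspose_eq_transpose_of_trivial] at this

theorem exp_conj_diagonal {U : Matrix m m ℝ} (hU : Uᵀ * U = 1) (d : m → ℝ) :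
    NormedSpace.exp (U * diagonal d * Uᵀ) = U * diagonal (fun i => Real.exp (d i)) * Uᵀ := by
  have hinv : U⁻¹ = Uᵀ := inv_eq_left_inv hU
  have hu : IsUnit U := (isUnit_iff_isUnit_det _).2 (isUnit_det_of_left_inverse hU)
  rw [← hinv, exp_conj _ _ hu, exp_diagonal]
  congr 3
  funext i
  rw [Pi.coe_exp, Real.exp_eq_exp_ℝ]

theorem exists_conj_diagonal_eigenvalues {A : Matrix m m ℝ} (hA : A.IsHermitian) :
    ∃ U : Matrix m m ℝ, Uᵀ * U = 1 ∧ U * Uᵀ = 1 ∧ A = U * diagonal hA.eigenvalues * Uᵀ := by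
  refine ⟨hA.eigenvectorUnitary, ?_, ?_, ?_⟩
  · have := Unitary.coe_star_mul_self hA.eigenvectorUnitary
    rwa [star_eq_conjTranspose, conjTranspose_eq_transpose_of_trivial] at this
  · have := Unitary.coe_mul_star_self hA.eigenvectorUnitary
    rwa [Unitary.coe_star, star_eq_conjTranspose, conjTranspose_eq_transpose_of_trivial] at this
  · have := hA.spectral_theorem
    rw [Unitary.conjStarAlgAut_apply, star_eq_conjTranspose,
      conjTranspose_eq_transpose_of_trivial] at this
    exact this

theorem exists_conj_diagonal {A : Matrix m m ℝ} (hA : A.IsSymm) :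
    ∃ (U : Matrix m m ℝ) (d : m → ℝ), Uᵀ * U = 1 ∧ U * Uᵀ = 1 ∧ A = U * diagonal d * Uᵀ := by
  have hH : A.IsHermitian := by
    rw [Matrix.IsHermitian, Matrix.conjTranspose_eq_transpose_of_trivial]; exact hA
  obtain ⟨U, h⟩ := exists_conj_diagonal_eigenvalues hH
  exact ⟨U, _, h⟩

theorem conj_diagonal_mul {U : Matrix m m ℝ} (hU : Uᵀ * U = 1) (e f : m → ℝ) :
    (U * diagonal e * Uᵀ) * (U * diagonal f * Uᵀ) = U * diagonal (fun i => e i * f i) * Uᵀ := by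
  rw [← diagonal_mul_diagonal]
  calc _ = U * diagonal e * (Uᵀ * U) * diagonal f * Uᵀ := by simp only [mul_assoc]
    _ = _ := by rw [hU, mul_one]; simp only [mul_assoc]

theorem conj_diagonal_sub (U : Matrix m m ℝ) (e f : m → ℝ) :
    U * diagonal e * Uᵀ - U * diagonal f * Uᵀ = U * diagonal (fun i => e i - f i) * Uᵀ := by
  rw [← diagonal_sub, mul_sub, sub_mul]

theorem conj_diagonal_add (U : Matrix m m ℝ) (e f : m → ℝ) :
    U * diagonal e * Uᵀ + U * diagonal f * Uᵀ = U * diagonal (fun i => e i + f i) * Uᵀ := by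
  rw [← diagonal_add, mul_add, add_mul]

theorem smul_conj_diagonal (U : Matrix m m ℝ) (c : ℝ) (e : m → ℝ) :
    c • (U * diagonal e * Uᵀ) = U * diagonal (fun i => c * e i) * Uᵀ := by
  have : (fun i => c * e i) = c • e := rfl
  rw [this, diagonal_smul, Matrix.mul_smul, Matrix.smul_mul]

theorem posSemidef_exp {A : Matrix m m ℝ} (hA : A.IsSymm) : (NormedSpace.exp A).PosSemidef := by
  obtain ⟨U, d, hU, -, rfl⟩ := exists_conj_diagonal hA
  rw [exp_conj_diagonal hU]
  exact posSemidef_conj_diagonal U fun i => (Real.exp_pos _).le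

/-- Jensen's inequality for `exp`, with the squared coordinates of `x` in an eigenbasis as weights.
-/
theorem exp_dotProduct_le {A : Matrix m m ℝ} (hA : A.IsSymm) {x : m → ℝ} (hx : x ⬝ᵥ x = 1) :
    Real.exp (x ⬝ᵥ A *ᵥ x) ≤ x ⬝ᵥ NormedSpace.exp A *ᵥ x := by
  obtain ⟨U, d, hU, hU', rfl⟩ := exists_conj_diagonal hA
  rw [exp_conj_diagonal hU, dotProduct_conj_diagonal, dotProduct_conj_diagonal]
  have h1 : ∑ i, (Uᵀ *ᵥ x) i ^ 2 = 1 := by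
    have := dotProduct_conj_diagonal U (fun _ => 1) x
    simp only [diagonal_one, mul_one, hU', one_mulVec, one_mul] at this
    rw [← this, hx]
  have := convexOn_exp.map_sum_le (t := Finset.univ) (w := fun i => (Uᵀ *ᵥ x) i ^ 2) (p := d)
    (fun i _ => sq_nonneg _) h1 (fun i _ => Set.mem_univ _)
  simpa only [smul_eq_mul, mul_comm] using this

omit [DecidableEq m] in
-- Write `P` as a sum of rank-one matrices `a aᵀ`; each contributes `aᵀ Q a`.
theorem trace_mul_nonneg {P Q : Matrix m m ℝ} (hP : P.PosSemidef) (hQ : Q.PosSemidef) :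
    0 ≤ (P * Q).trace := by
  obtain ⟨k, a, rfl⟩ := posSemidef_iff_eq_sum_vecMulVec.1 hP
  rw [Finset.sum_mul, trace_sum]
  refine Finset.sum_nonneg fun i _ => ?_
  rw [trace_mul_comm, mul_vecMulVec, trace_vecMulVec, dotProduct_comm]
  exact hQ.dotProduct_mulVec_nonneg (a i)

/-- By Cauchy–Schwarz `1 - x xᵀ` is positive semidefinite, so its product with `P` has nonnegative
trace. -/
theorem dotProduct_mulVec_le_trace {P : Matrix m m ℝ} (hP : P.PosSemidef) {x : m → ℝ}
    (hx : x ⬝ᵥ x = 1) : x ⬝ᵥ P *ᵥ x ≤ P.trace := by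
  have h1 : (1 - vecMulVec x x).PosSemidef := by
    refine PosSemidef.of_dotProduct_mulVec_nonneg ?_ fun y => ?_
    · rw [Matrix.IsHermitian, conjTranspose_eq_transpose_of_trivial]
      simp [transpose_sub, transpose_vecMulVec]
    · rw [star_trivial, sub_mulVec, dotProduct_sub, one_mulVec, vecMulVec_mulVec, dotProduct_smul]
      have h := Finset.sum_mul_sq_le_sq_mul_sq Finset.univ x y
      have hxx : ∑ i, x i ^ 2 = 1 := by rw [← hx, dotProduct]; simp only [pow_two]
      have hyy : ∑ i, y i ^ 2 = y ⬝ᵥ y := by rw [dotProduct]; simp only [pow_two]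
      rw [hxx, one_mul, hyy] at h
      have hxy : y ⬝ᵥ x = x ⬝ᵥ y := dotProduct_comm _ _
      change (x ⬝ᵥ y) ^ 2 ≤ _ at h
      simp [hxy]
      nlinarith
  have := trace_mul_nonneg hP h1
  rw [mul_sub, mul_one, trace_sub, mul_vecMulVec, trace_vecMulVec] at this
  rw [dotProduct_comm]
  linarith

/-- Use `exp x ≤ 1 + x + x²` on `[-1, 1]`: the linear term averages to zero, the quadratic one to `u
= s² p (1 - p)`, and `1 + u ≤ exp u` is absorbed by the compensator. -/
theorem bernoulli_mgf_le {p s : ℝ} (hp0 : 0 ≤ p) (hp1 : p ≤ 1) (hs : |s| ≤ 1) :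
    (1 - p) * Real.exp (s * (0 - p) - s ^ 2 * (p * (1 - p))) +
      p * Real.exp (s * (1 - p) - s ^ 2 * (p * (1 - p))) ≤ 1 := by
  have key : ∀ x : ℝ, |x| ≤ 1 → Real.exp x ≤ 1 + x + x ^ 2 := by
    intro x hx
    have := abs_le.1 (Real.abs_exp_sub_one_sub_id_le hx)
    linarith [this.2]
  have h0 := key (s * (0 - p)) (by
    rw [abs_mul]
    have : |0 - p| ≤ 1 := by rw [abs_le]; constructor <;> linarith
    nlinarith [abs_nonneg s, abs_nonneg (0 - p)])
  have h1 := key (s * (1 - p)) (by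
    rw [abs_mul]
    have : |1 - p| ≤ 1 := by rw [abs_le]; constructor <;> linarith
    nlinarith [abs_nonneg s, abs_nonneg (1 - p)])
  rw [Real.exp_sub, Real.exp_sub, ← mul_div_assoc, ← mul_div_assoc, ← add_div,
    div_le_one (Real.exp_pos _)]
  have h2 := Real.add_one_le_exp (s ^ 2 * (p * (1 - p)))
  have := mul_le_mul_of_nonneg_left h0 (sub_nonneg.2 hp1)
  have := mul_le_mul_of_nonneg_left h1 hp0
  nlinarith

/-- All matrices involved are functions of `F`, so it suffices to treat each eigenvalue `d i`. The
relation `F³ = F` gives `|d i| ≤ 1`, and the scalar bound applies with `s * d i`. -/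
theorem posSemidef_one_sub_matrix_mgf {F : Matrix m m ℝ} (hF : F.IsSymm) (hF3 : F * F * F = F)
    {p s : ℝ} (hp0 : 0 ≤ p) (hp1 : p ≤ 1) (hs : |s| ≤ 1) :
    (1 - ((1 - p) • NormedSpace.exp ((s * (0 - p)) • F - (s ^ 2 * (p * (1 - p))) • (F * F)) +
      p • NormedSpace.exp ((s * (1 - p)) • F - (s ^ 2 * (p * (1 - p))) • (F * F)))).PosSemidef := by
  obtain ⟨U, d, hU, hU', rfl⟩ := exists_conj_diagonal hF
  have hone : (1 : Matrix m m ℝ) = U * diagonal (fun _ => 1) * Uᵀ := by simp [hU']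
  have hd : ∀ i, |d i| ≤ 1 := by
    intro i
    have h := congrArg (fun M => (Uᵀ * M * U) i i) hF3
    have hc : ∀ e : m → ℝ, Uᵀ * (U * diagonal e * Uᵀ) * U = diagonal e := by
      intro e
      calc _ = (Uᵀ * U) * diagonal e * (Uᵀ * U) := by simp only [mul_assoc]
        _ = _ := by rw [hU, mul_one, one_mul]
    simp only [conj_diagonal_mul hU, hc, diagonal_apply_eq] at h
    rw [abs_le]
    constructor <;> by_contra hc <;> push Not at hc <;> nlinarith [sq_nonneg (d i)]
  simp only [conj_diagonal_mul hU, smul_conj_diagonal, conj_diagonal_sub, exp_conj_diagonal hU,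
    conj_diagonal_add]
  rw [hone, conj_diagonal_sub]
  refine posSemidef_conj_diagonal U fun i => ?_
  have h := bernoulli_mgf_le hp0 hp1 (s := s * d i) (by
    rw [abs_mul]; nlinarith [abs_nonneg s, abs_nonneg (d i), hd i])
  rw [sub_nonneg]
  convert h using 5 <;> ring

end Spectral

/-! ### The expected trace exponential of a sum of independent terms. -/

section MatrixBernstein

variable {m : Type*} [Fintype m]

/-- The exponent that a Bernoulli variable with value `x` and mean `p` contributes in the
direction `F`: the centered term, minus a compensator of its variance. -/
def compensatedTerm (F : Matrix m m ℝ) (s p x : ℝ) : Matrix m m ℝ :=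
  (s * (x - p)) • F - (s ^ 2 * (p * (1 - p))) • (F * F)

theorem isSymm_compensatedTerm {F : Matrix m m ℝ} (hF : F.IsSymm) (s p x : ℝ) :
    (compensatedTerm F s p x).IsSymm := by
  refine (hF.smul _).sub (IsSymm.smul ?_ _)
  rw [IsSymm, transpose_mul, hF.eq]

variable [DecidableEq m]

theorem continuous_exp_matrix : Continuous (NormedSpace.exp : Matrix m m ℝ → Matrix m m ℝ) := by
  open scoped Matrix.Norms.Operator in
  let _ : NormedAlgebra ℚ (Matrix m m ℝ) := NormedAlgebra.restrictScalars ℚ ℝ _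
  exact NormedSpace.exp_continuous

variable {ι Ω : Type*} [Fintype ι] [DecidableEq ι] [MeasurableSpace Ω] {P : Measure Ω}
  [IsProbabilityMeasure P]

omit [DecidableEq ι] in
theorem integrable_comp_of_continuous {ξ : ι → Ω → ℝ} (hmeas : ∀ e, Measurable (ξ e))
    (h01 : ∀ e ω, ξ e ω = 0 ∨ ξ e ω = 1) {g : (ι → ℝ) → ℝ} (hg : Continuous g) :
    Integrable (fun ω => g fun e => ξ e ω) P := by
  obtain ⟨C, hC⟩ := (isCompact_univ_pi fun _ : ι => isCompact_Icc (a := (0 : ℝ)) (b := 1)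
    ).exists_bound_of_continuousOn hg.continuousOn
  refine Integrable.of_bound (hg.measurable.comp (measurable_pi_lambda _ hmeas)).aestronglyMeasurable
    C (Filter.Eventually.of_forall fun ω => hC _ fun e _ => ?_)
  rcases h01 e ω with h | h <;> simp [h]

/-- Induction on the set of variables: Golden–Thompson isolates the factor of the new one,
independence replaces it by its mean, and that mean is at most the identity. The bound thus never
grows beyond the trace of the identity. -/
theorem integral_trace_exp_sum_le {F : ι → Matrix m m ℝ} (hF : ∀ e, (F e).IsSymm)
    (hF3 : ∀ e, F e * F e * F e = F e) {p : ι → ℝ} (hp0 : ∀ e, 0 ≤ p e) (hp1 : ∀ e, p e ≤ 1)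
    {ξ : ι → Ω → ℝ} (hmeas : ∀ e, Measurable (ξ e)) (h01 : ∀ e ω, ξ e ω = 0 ∨ ξ e ω = 1)
    (hmean : ∀ e, ∫ ω, ξ e ω ∂P = p e) (hind : iIndepFun ξ P) {s : ℝ} (hs : |s| ≤ 1)
    (S : Finset ι) :
    ∫ ω, (NormedSpace.exp (∑ e ∈ S, compensatedTerm (F e) s (p e) (ξ e ω))).trace ∂P ≤
      Fintype.card m := by
  induction S using Finset.induction_on with
  | empty => simp [trace_one]
  | insert e S he ih =>
    let H : (ι → ℝ) → Matrix m m ℝ := fun x => ∑ i ∈ S, compensatedTerm (F i) s (p i) (x i)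
    let E : ℝ → Matrix m m ℝ := fun x => NormedSpace.exp (compensatedTerm (F e) s (p e) x)
    have hH : Continuous H := by
      refine continuous_finsetSum _ fun i _ => ?_
      unfold compensatedTerm
      fun_prop
    have hHs : ∀ x, (H x).IsSymm := fun x => by
      rw [IsSymm, transpose_sum]
      exact Finset.sum_congr rfl fun i _ => isSymm_compensatedTerm (hF i) _ _ _
    have hc : ∀ M : Matrix m m ℝ, Continuous fun x => (NormedSpace.exp (H x) * M).trace :=
      fun M => ((continuous_exp_matrix.comp hH).matrix_mul continuous_const).matrix_trace
    have hint : ∀ M : Matrix m m ℝ,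
        Integrable (fun ω => (NormedSpace.exp (H fun i => ξ i ω) * M).trace) P :=
      fun M => integrable_comp_of_continuous hmeas h01 (hc M)
    have hintξ : Integrable (fun ω => ξ e ω *
        (NormedSpace.exp (H fun i => ξ i ω) * (E 1 - E 0)).trace) P :=
      integrable_comp_of_continuous hmeas h01 ((continuous_apply e).mul (hc _))
    have hindep : IndepFun (ξ e)
        (fun ω => (NormedSpace.exp (H fun i => ξ i ω) * (E 1 - E 0)).trace) P := by
      have h := hind.indepFun_finset {e} S (by simpa using he) hmeas
      -- `H` takes a full family but reads only the indices in `S`; extension by zero makes it a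
      -- function of the restricted family.
      let ext : (S → ℝ) → ι → ℝ := fun y i => if h : i ∈ S then y ⟨i, h⟩ else 0
      have hext : Continuous ext := by
        refine continuous_pi fun i => ?_
        by_cases hi : i ∈ S
        · simpa [ext, hi] using continuous_apply _
        · simpa [ext, hi] using continuous_const
      have hφ : Measurable fun y : ({e} : Finset ι) → ℝ => y ⟨e, Finset.mem_singleton_self e⟩ :=
        measurable_pi_apply _
      have h' := h.comp
        (ψ := fun y => (NormedSpace.exp (H (ext y)) * (E 1 - E 0)).trace)
        hφ ((hc _).comp hext).measurable
      have hHext : ∀ ω, H (fun i => ξ i ω) = H (ext fun i => ξ i ω) := fun ω =>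
        Finset.sum_congr rfl fun i hi => by simp [ext, hi]
      simp only [hHext]
      exact h'
    -- As `ξ e` takes the values 0 and 1, `E (ξ e)` equals `E 0 + ξ e • (E 1 - E 0)`. This is affine
    -- in `ξ e`, so only the mean matters.
    have hstep : ∀ ω, (NormedSpace.exp (∑ i ∈ insert e S,
        compensatedTerm (F i) s (p i) (ξ i ω))).trace ≤
        (NormedSpace.exp (H fun i => ξ i ω) * E 0).trace + ξ e ω *
          (NormedSpace.exp (H fun i => ξ i ω) * (E 1 - E 0)).trace := by
      intro ω
      rw [Finset.sum_insert he, add_comm]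
      refine (trace_exp_add_le _ _ (hHs fun i => ξ i ω)
        (isSymm_compensatedTerm (hF e) _ _ _)).trans_eq ?_
      rcases h01 e ω with h | h <;> simp [h, mul_sub, E, H]
    have hM : (1 - ((1 - p e) • E 0 + p e • E 1)).PosSemidef :=
      posSemidef_one_sub_matrix_mgf (hF e) (hF3 e) (hp0 e) (hp1 e) hs
    have hle : ∀ ω, (NormedSpace.exp (H fun i => ξ i ω) * E 0).trace + p e *
        (NormedSpace.exp (H fun i => ξ i ω) * (E 1 - E 0)).trace ≤
        (NormedSpace.exp (H fun i => ξ i ω) * 1).trace := by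
      intro ω
      have h := trace_mul_nonneg (posSemidef_exp (hHs fun i => ξ i ω)) hM
      simp only [mul_sub, mul_add, Matrix.mul_smul, trace_sub, trace_add, trace_smul,
        smul_eq_mul] at h ⊢
      linarith
    have hm := fun M => (hint M).aestronglyMeasurable
    calc _ ≤ ∫ ω, ((NormedSpace.exp (H fun i => ξ i ω) * E 0).trace + ξ e ω *
          (NormedSpace.exp (H fun i => ξ i ω) * (E 1 - E 0)).trace) ∂P := by
          refine integral_mono ?_ ((hint _).add hintξ) hstep
          refine integrable_comp_of_continuous hmeas h01
            (g := fun x => (NormedSpace.exp (∑ i ∈ insert e S,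
              compensatedTerm (F i) s (p i) (x i))).trace) ?_
          refine (continuous_exp_matrix.comp (continuous_finsetSum _ fun i _ => ?_)).matrix_trace
          unfold compensatedTerm
          fun_prop
      _ = ∫ ω, ((NormedSpace.exp (H fun i => ξ i ω) * E 0).trace + p e *
          (NormedSpace.exp (H fun i => ξ i ω) * (E 1 - E 0)).trace) ∂P := by
          rw [integral_add (hint _) hintξ, integral_add (hint _) ((hint _).const_mul _),
            hindep.integral_fun_mul_eq_mul_integral (hmeas e).aestronglyMeasurable (hm _),
            hmean, integral_const_mul]
      _ ≤ ∫ ω, (NormedSpace.exp (H fun i => ξ i ω) * 1).trace ∂P := by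
          refine integral_mono ?_ (hint 1) hle
          exact (hint _).add ((hint _).const_mul _)
      _ ≤ Fintype.card m := by simpa only [mul_one] using ih

end MatrixBernstein

/-! ### Decomposition of a symmetric matrix into single edges. -/

section EdgeMatrix

variable {n : ℕ}

/-- The adjacency matrix of the graph whose only edge is `{i,j}`. -/
def edgeMatrix (e : Fin n × Fin n) : Matrix (Fin n) (Fin n) ℝ :=
  of fun a b => if (a = e.1 ∧ b = e.2) ∨ (a = e.2 ∧ b = e.1) then 1 else 0

theorem isSymm_edgeMatrix (e : Fin n × Fin n) : (edgeMatrix e).IsSymm := by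
  ext a b
  simp only [edgeMatrix, transpose_apply, of_apply]
  congr 1
  grind

/-- Each row has at most one nonzero entry, so the square is diagonal and marks the endpoints; this
covers loops too. -/
theorem edgeMatrix_mul_self (e : Fin n × Fin n) :
    edgeMatrix e * edgeMatrix e = diagonal fun a => ∑ b, edgeMatrix e a b := by
  ext a b
  simp only [mul_apply, diagonal_apply, edgeMatrix, of_apply, mul_ite, mul_one, mul_zero]
  split_ifs with h
  · subst h
    exact Finset.sum_congr rfl fun c _ => by grind
  · exact Finset.sum_eq_zero fun c _ => by grind

theorem edgeMatrix_mul_self_mul_self (e : Fin n × Fin n) :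
    edgeMatrix e * edgeMatrix e * edgeMatrix e = edgeMatrix e := by
  rw [edgeMatrix_mul_self]
  ext a b
  rw [diagonal_mul]
  by_cases h : (a = e.1 ∧ b = e.2) ∨ (a = e.2 ∧ b = e.1)
  · rw [Finset.sum_eq_single b]
    · simp [edgeMatrix, h]
    · intro c _ hc
      simp only [edgeMatrix, of_apply]
      rw [if_neg]
      grind
    · simp
  · simp [edgeMatrix, h]

theorem sum_smul_edgeMatrix {M : Matrix (Fin n) (Fin n) ℝ} (hM : M.IsSymm) :
    ∑ e : {e : Fin n × Fin n // e.1 ≤ e.2}, M e.1.1 e.1.2 • edgeMatrix e.1 = M := by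
  ext a b
  rw [Matrix.sum_apply]
  simp only [Matrix.smul_apply, smul_eq_mul]
  rw [Finset.sum_eq_single ⟨(min a b, max a b), min_le_max⟩]
  · rcases le_total a b with h | h
    · simp [h, edgeMatrix]
    · simp [h, edgeMatrix, hM.apply]
  · rintro ⟨⟨i, j⟩, hij⟩ _ hne
    simp only [edgeMatrix, of_apply]
    rw [if_neg, mul_zero]
    rintro (⟨rfl, rfl⟩ | ⟨rfl, rfl⟩) <;> apply hne <;> simp at hij <;> simp [hij]
  · simp

/-- The sum of squares is the diagonal matrix of row sums of `M`. With the edge variances as `M`,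
this bounds the total compensator. -/
theorem dotProduct_sum_edgeMatrix_sq_le {M : Matrix (Fin n) (Fin n) ℝ} (hM : M.IsSymm) {d : ℝ}
    (hd : ∀ a, ∑ b, M a b ≤ d) {x : Fin n → ℝ} (hx : x ⬝ᵥ x = 1) :
    x ⬝ᵥ (∑ e : {e : Fin n × Fin n // e.1 ≤ e.2},
      M e.1.1 e.1.2 • (edgeMatrix e.1 * edgeMatrix e.1)) *ᵥ x ≤ d := by
  have h : ∑ e : {e : Fin n × Fin n // e.1 ≤ e.2},
      M e.1.1 e.1.2 • (edgeMatrix e.1 * edgeMatrix e.1) = diagonal fun a => ∑ b, M a b := by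
    ext a b
    conv_rhs => rw [← sum_smul_edgeMatrix hM]
    simp only [edgeMatrix_mul_self, Matrix.sum_apply, Matrix.smul_apply, diagonal_apply, smul_eq_mul]
    split_ifs
    · rw [Finset.sum_comm]
      simp only [Finset.mul_sum]
    · simp
  rw [h]
  calc _ = ∑ a, (∑ b, M a b) * (x a * x a) := by
        simp only [dotProduct, mulVec_diagonal]
        exact Finset.sum_congr rfl fun a _ => by ring
    _ ≤ ∑ a, d * (x a * x a) := Finset.sum_le_sum fun a _ =>
        mul_le_mul_of_nonneg_right (hd a) (mul_self_nonneg _)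
    _ = d := by rw [← Finset.mul_sum]; exact (congrArg (d * ·) hx).trans (mul_one d)

end EdgeMatrix

/-! ### Concentration of the random adjacency matrix. -/

section Sampled

variable {n : ℕ} {Ω : Type*} [MeasurableSpace Ω] {P : Measure Ω}
  {A : Ω → Matrix (Fin n) (Fin n) ℝ} {Abar : Matrix (Fin n) (Fin n) ℝ}

theorem IsSampledFrom.integral_eq (hA : IsSampledFrom P A Abar) (h0 : ∀ i j, 0 ≤ Abar i j)
    (i j : Fin n) : ∫ ω, A ω i j ∂P = Abar i j := by
  have h : (fun ω => A ω i j) = {ω | A ω i j = 1}.indicator 1 := by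
    funext ω
    rcases hA.zero_or_one ω i j with h | h <;> simp [h]
  have hm : MeasurableSet {ω | A ω i j = 1} := hA.measurable i j (measurableSet_singleton 1)
  rw [h, integral_indicator_one hm, measureReal_def,
    hA.prob_edge, ENNReal.toReal_ofReal (h0 i j)]

/-- The compensated exponent `s (A - Abar) - s² D`, where `D` is the diagonal matrix that holds
the sums of the variances of the edges at each vertex. -/
def compensatedSum (A Abar : Matrix (Fin n) (Fin n) ℝ) (s : ℝ) : Matrix (Fin n) (Fin n) ℝ :=
  ∑ e : {e : Fin n × Fin n // e.1 ≤ e.2},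
    compensatedTerm (edgeMatrix e.1) s (Abar e.1.1 e.1.2) (A e.1.1 e.1.2)

theorem isSymm_compensatedSum (A Abar : Matrix (Fin n) (Fin n) ℝ) (s : ℝ) :
    (compensatedSum A Abar s).IsSymm := by
  rw [compensatedSum, IsSymm, transpose_sum]
  exact Finset.sum_congr rfl fun e _ => isSymm_compensatedTerm (isSymm_edgeMatrix _) _ _ _

/-- The variances satisfy `p (1 - p) ≤ p`, so their row sums are at most `dMax Abar`. -/
theorem le_dotProduct_compensatedSum {A : Matrix (Fin n) (Fin n) ℝ} (hA : A.IsSymm)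
    (hAbar : IsEdgeProbMatrix Abar) (s : ℝ) {x : Fin n → ℝ} (hx : x ⬝ᵥ x = 1) :
    s * (x ⬝ᵥ (A - Abar) *ᵥ x) - s ^ 2 * dMax Abar ≤ x ⬝ᵥ compensatedSum A Abar s *ᵥ x := by
  let V : Matrix (Fin n) (Fin n) ℝ := of fun i j => Abar i j * (1 - Abar i j)
  have hV : V.IsSymm := by
    ext i j
    simp [V, hAbar.symm.apply]
  have h : compensatedSum A Abar s = s • (A - Abar) - s ^ 2 •
      ∑ e : {e : Fin n × Fin n // e.1 ≤ e.2},
        V e.1.1 e.1.2 • (edgeMatrix e.1 * edgeMatrix e.1) := by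
    conv_rhs => rw [← sum_smul_edgeMatrix (hA.sub hAbar.symm)]
    simp only [compensatedSum, compensatedTerm, Finset.sum_sub_distrib, Finset.smul_sum, smul_smul]
    rfl
  have hd : ∀ a, ∑ b, V a b ≤ dMax Abar := by
    intro a
    refine le_trans (Finset.sum_le_sum fun b _ => ?_)
      (le_ciSup (f := fun i => ∑ j, Abar i j) (Set.finite_range _).bddAbove a)
    simp only [V, of_apply]
    nlinarith [hAbar.nonneg a b]
  have := dotProduct_sum_edgeMatrix_sq_le hV hd hx
  rw [h, sub_mulVec (s • (A - Abar)), dotProduct_sub, smul_mulVec, smul_mulVec, dotProduct_smul, dotProduct_smul,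
    smul_eq_mul, smul_eq_mul]
  nlinarith [sq_nonneg s]

variable [IsProbabilityMeasure P]

/-- Markov's inequality for the trace exponential. -/
theorem measureReal_exp_le_trace_le (hA : IsSampledFrom P A Abar) (hAbar : IsEdgeProbMatrix Abar)
    {s : ℝ} (hs : |s| ≤ 1) (t : ℝ) :
    P.real {ω | Real.exp t ≤ (NormedSpace.exp (compensatedSum (A ω) Abar s)).trace} ≤
      n * Real.exp (-t) := by
  have h := integral_trace_exp_sum_le (P := P) (ι := {e : Fin n × Fin n // e.1 ≤ e.2})
    (fun e => isSymm_edgeMatrix e.1) (fun e => edgeMatrix_mul_self_mul_self e.1)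
    (fun e => hAbar.nonneg e.1.1 e.1.2) (fun e => hAbar.le_one e.1.1 e.1.2)
    (fun e => hA.measurable e.1.1 e.1.2) (fun e ω => hA.zero_or_one ω e.1.1 e.1.2)
    (fun e => hA.integral_eq hAbar.nonneg e.1.1 e.1.2) hA.indep hs Finset.univ
  have hint : Integrable (fun ω => (NormedSpace.exp (compensatedSum (A ω) Abar s)).trace) P := by
    refine integrable_comp_of_continuous (ι := {e : Fin n × Fin n // e.1 ≤ e.2})
      (fun e => hA.measurable e.1.1 e.1.2) (fun e ω => hA.zero_or_one ω e.1.1 e.1.2)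
      (g := fun x => (NormedSpace.exp (∑ e : {e : Fin n × Fin n // e.1 ≤ e.2},
        compensatedTerm (edgeMatrix e.1) s (Abar e.1.1 e.1.2) (x e))).trace) ?_
    refine (continuous_exp_matrix.comp (continuous_finsetSum _ fun i _ => ?_)).matrix_trace
    unfold compensatedTerm
    fun_prop
  have hM := mul_meas_ge_le_integral_of_nonneg (Filter.Eventually.of_forall fun ω =>
    (posSemidef_exp (isSymm_compensatedSum (A ω) Abar s)).trace_nonneg) hint (Real.exp t)
  rw [Real.exp_neg, ← div_eq_mul_inv, le_div_iff₀' (Real.exp_pos t)]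
  refine hM.trans (h.trans_eq ?_)
  rw [Fintype.card_fin]

/-- A matrix Bernstein bound for the adjacency matrix of a random graph with independent edges. -/
theorem one_sub_le_measureReal_quadratic_form (hA : IsSampledFrom P A Abar)
    (hAbar : IsEdgeProbMatrix Abar) {s : ℝ} (hs0 : 0 < s) (hs1 : s ≤ 1) (t : ℝ) :
    1 - 2 * n * Real.exp (-t) ≤ P.real {ω | ∀ x : Fin n → ℝ, x ⬝ᵥ x = 1 →
      |x ⬝ᵥ (A ω - Abar) *ᵥ x| ≤ (t + s ^ 2 * dMax Abar) / s} := by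
  let B : ℝ → Set Ω := fun s =>
    {ω | Real.exp t ≤ (NormedSpace.exp (compensatedSum (A ω) Abar s)).trace}
  have h1 := measureReal_exp_le_trace_le hA hAbar (s := s) (by rwa [abs_of_pos hs0]) t
  have h2 := measureReal_exp_le_trace_le hA hAbar (s := -s) (by rwa [abs_neg, abs_of_pos hs0]) t
  have hsub : (B s ∪ B (-s))ᶜ ⊆ {ω | ∀ x : Fin n → ℝ, x ⬝ᵥ x = 1 →
      |x ⬝ᵥ (A ω - Abar) *ᵥ x| ≤ (t + s ^ 2 * dMax Abar) / s} := by
    intro ω hω x hx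
    -- Off the bad event, `exp (xᵀ S x) ≤ xᵀ (exp S) x ≤ tr (exp S) < exp t` for all unit `x` at
    -- once. The parameters `s` and `-s` give the two signs.
    have key : ∀ r : ℝ, ω ∉ B r → r * (x ⬝ᵥ (A ω - Abar) *ᵥ x) - r ^ 2 * dMax Abar < t := by
      intro r hr
      refine (le_dotProduct_compensatedSum (hA.symm ω) hAbar r hx).trans_lt ?_
      have hr' := lt_of_not_ge (show ¬ Real.exp t ≤ _ from hr)
      have hS := isSymm_compensatedSum (A ω) Abar r
      exact Real.exp_lt_exp.1 ((exp_dotProduct_le hS hx).trans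
        (dotProduct_mulVec_le_trace (posSemidef_exp hS) hx) |>.trans_lt hr')
    have k1 := key s fun h => hω (Or.inl h)
    have k2 := key (-s) fun h => hω (Or.inr h)
    rw [abs_le, neg_le, le_div_iff₀ hs0, le_div_iff₀ hs0]
    constructor <;> nlinarith
  have h3 := measureReal_mono (μ := P) hsub
  have h4 : (1 : ℝ) ≤ P.real (B s ∪ B (-s)) + P.real (B s ∪ B (-s))ᶜ := by
    rw [← probReal_univ (μ := P), ← Set.union_compl_self (B s ∪ B (-s))]
    exact measureReal_union_le _ _
  have h5 := measureReal_union_le (μ := P) (B s) (B (-s))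
  linarith

end Sampled

/-! ### Perturbation of the top eigenvector. -/

section Deterministic

variable {m : Type*} [Fintype m] [DecidableEq m]

theorem transpose_mulVec_dotProduct {U : Matrix m m ℝ} (hU : U * Uᵀ = 1) (x y : m → ℝ) :
    (Uᵀ *ᵥ x) ⬝ᵥ (Uᵀ *ᵥ y) = x ⬝ᵥ y := by
  rw [dotProduct_mulVec, vecMul_transpose, mulVec_mulVec, hU, one_mulVec]

/-- The quadratic form of a symmetric matrix whose top eigenvalue `d k` is simple, in terms of
the correlation with a top eigenvector. -/
theorem dotProduct_mulVec_le_of_gap {U : Matrix m m ℝ} {d : m → ℝ} (hU : Uᵀ * U = 1)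
    (hU' : U * Uᵀ = 1) {k : m} {ν : ℝ} (hν : ν < d k) (hd : ∀ i, i ≠ k → d i ≤ ν)
    {v x : m → ℝ} (hv : v ⬝ᵥ v = 1) (hvA : (U * diagonal d * Uᵀ) *ᵥ v = d k • v)
    (hx : x ⬝ᵥ x = 1) :
    x ⬝ᵥ (U * diagonal d * Uᵀ) *ᵥ x ≤ ν + (d k - ν) * (v ⬝ᵥ x) ^ 2 := by
  -- The eigenvalue `d k` is strictly above the others, so `v` is plus or minus the `k`-th column of
  -- `U`.
  have hw : ∀ i, i ≠ k → (Uᵀ *ᵥ v) i = 0 := by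
    intro i hi
    have h := congrFun (congrArg (Uᵀ *ᵥ ·) hvA) i
    simp only [mulVec_mulVec, ← mul_assoc, hU, one_mul] at h
    rw [← mulVec_mulVec, mulVec_diagonal, mulVec_smul, Pi.smul_apply, smul_eq_mul] at h
    have h' : (d k - d i) * (Uᵀ *ᵥ v) i = 0 := by linarith
    rcases mul_eq_zero.1 h' with h' | h'
    · linarith [hd i hi]
    · exact h'
  have hsum : ∀ y : m → ℝ, v ⬝ᵥ y = (Uᵀ *ᵥ v) k * (Uᵀ *ᵥ y) k := by
    intro y
    rw [← transpose_mulVec_dotProduct hU', dotProduct, Finset.sum_eq_single k]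
    · intro i _ hi
      rw [hw i hi, zero_mul]
    · simp
  have hvk : (Uᵀ *ᵥ v) k ^ 2 = 1 := by rw [pow_two, ← hsum, hv]
  have hvx : (v ⬝ᵥ x) ^ 2 = (Uᵀ *ᵥ x) k ^ 2 := by rw [hsum, mul_pow, hvk, one_mul]
  have hx1 : ∑ i, (Uᵀ *ᵥ x) i ^ 2 = 1 := by
    rw [← hx, ← transpose_mulVec_dotProduct hU' x x, dotProduct]
    simp only [pow_two]
  rw [hvx, dotProduct_conj_diagonal]
  have h1 : ∀ i, d i * (Uᵀ *ᵥ x) i ^ 2 ≤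
      ν * (Uᵀ *ᵥ x) i ^ 2 + if i = k then (d k - ν) * (Uᵀ *ᵥ x) k ^ 2 else 0 := by
    intro i
    split_ifs with h
    · subst h; linarith
    · have := mul_le_mul_of_nonneg_right (hd i h) (sq_nonneg ((Uᵀ *ᵥ x) i))
      linarith
  refine (Finset.sum_le_sum fun i _ => h1 i).trans_eq ?_
  rw [Finset.sum_add_distrib, ← Finset.mul_sum, hx1, mul_one]
  simp

theorem dotProduct_mulVec_le_max {U : Matrix m m ℝ} {d : m → ℝ} (hU' : U * Uᵀ = 1) {k : m}
    (hd : ∀ i, d i ≤ d k) {x : m → ℝ} (hx : x ⬝ᵥ x = 1) :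
    x ⬝ᵥ (U * diagonal d * Uᵀ) *ᵥ x ≤ d k := by
  have hx1 : ∑ i, (Uᵀ *ᵥ x) i ^ 2 = 1 := by
    rw [← hx, ← transpose_mulVec_dotProduct hU' x x, dotProduct]
    simp only [pow_two]
  rw [dotProduct_conj_diagonal]
  refine (Finset.sum_le_sum fun i _ =>
    mul_le_mul_of_nonneg_right (hd i) (sq_nonneg ((Uᵀ *ᵥ x) i))).trans_eq ?_
  rw [← Finset.mul_sum, hx1, mul_one]

/-- A perturbation bound for top eigenvectors, in the spirit of Davis and Kahan. -/
theorem gap_mul_one_sub_sq_le {A B U : Matrix m m ℝ} {d : m → ℝ} (hU : Uᵀ * U = 1)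
    (hU' : U * Uᵀ = 1) (hA : A = U * diagonal d * Uᵀ) {k : m} (hd : ∀ i, d i ≤ d k)
    {v : m → ℝ} (hv : v ⬝ᵥ v = 1) {μ ν : ℝ} (hvB : B *ᵥ v = μ • v)
    (hB : ∀ x, x ⬝ᵥ x = 1 → x ⬝ᵥ B *ᵥ x ≤ ν + (μ - ν) * (v ⬝ᵥ x) ^ 2)
    {M : ℝ} (hM : ∀ x, x ⬝ᵥ x = 1 → |x ⬝ᵥ (A - B) *ᵥ x| ≤ M) :
    (μ - ν) * (1 - (Uᵀ *ᵥ v) k ^ 2) ≤ 2 * M := by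
  have hu : (U *ᵥ Pi.single k 1) ⬝ᵥ (U *ᵥ Pi.single k 1) = 1 := by
    have := transpose_mulVec_dotProduct (U := Uᵀ) (by rwa [transpose_transpose])
      (Pi.single k 1) (Pi.single k 1)
    rw [transpose_transpose] at this
    rw [this]
    simp
  have huv : v ⬝ᵥ (U *ᵥ Pi.single k 1) = (Uᵀ *ᵥ v) k := by
    rw [dotProduct_mulVec, ← mulVec_transpose, dotProduct_single, mul_one]
  have huA : (U *ᵥ Pi.single k 1) ⬝ᵥ A *ᵥ (U *ᵥ Pi.single k 1) = d k := by
    rw [hA, dotProduct_conj_diagonal, mulVec_mulVec, hU, one_mulVec]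
    simp [Pi.single_apply]
  -- With `u` the `k`-th column of `U`: `μ - M ≤ vᵀ A v ≤ d k = uᵀ A u ≤ uᵀ B u + M ≤ ν + (μ - ν)
  -- ⟨v, u⟩² + M`.
  have h1 := dotProduct_mulVec_le_max (U := U) hU' hd hv
  rw [← hA] at h1
  have h2 := abs_le.1 (hM v hv)
  have h3 := abs_le.1 (hM _ hu)
  rw [sub_mulVec, dotProduct_sub] at h2 h3
  rw [hvB, dotProduct_smul, hv, smul_eq_mul, mul_one] at h2
  have h4 := hB _ hu
  rw [huv] at h4
  linarith [h2.1, h3.2]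

end Deterministic

/-! ### Welfare in an eigenbasis and the competitive ratio. -/

section Welfare

variable {n : ℕ}

theorem welfare_conj_diagonal {A U : Matrix (Fin n) (Fin n) ℝ} {d : Fin n → ℝ} {β : ℝ}
    (hU : Uᵀ * U = 1) (hU' : U * Uᵀ = 1) (hA : A = U * diagonal d * Uᵀ)
    (hd : ∀ i, β * d i < 1) (b y : EuclideanSpace ℝ (Fin n)) :
    welfare A β b y = 1 / 2 * ∑ i, (1 - β * d i)⁻¹ ^ 2 * (Uᵀ *ᵥ (b + y).ofLp) i ^ 2 := by
  have h1 : 1 - β • A = U * diagonal (fun i => 1 - β * d i) * Uᵀ := by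
    have hone : (1 : Matrix (Fin n) (Fin n) ℝ) = U * diagonal (fun _ => 1) * Uᵀ := by simp [hU']
    rw [hA, smul_conj_diagonal, hone, conj_diagonal_sub]
  have hinv : (U * diagonal (fun i => (1 - β * d i)⁻¹) * Uᵀ) * (1 - β • A) = 1 := by
    rw [h1, conj_diagonal_mul hU]
    have : (fun i => (1 - β * d i)⁻¹ * (1 - β * d i)) = fun _ => 1 := by
      funext i
      exact inv_mul_cancel₀ (sub_pos.2 (hd i)).ne'
    rw [this, diagonal_one, mul_one, hU']
  rw [welfare_eq A β b y (isUnit_det_of_left_inverse hinv), equilibrium, inv_eq_left_inv hinv]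
  have hs : (U * diagonal (fun i => (1 - β * d i)⁻¹) * Uᵀ)ᵀ =
      U * diagonal (fun i => (1 - β * d i)⁻¹) * Uᵀ := by
    simp [transpose_mul, mul_assoc]
  rw [dotProduct_mulVec, ← mulVec_transpose, hs, mulVec_mulVec, conj_diagonal_mul hU,
    dotProduct_comm, dotProduct_conj_diagonal]
  simp only [pow_two]

theorem exists_isOptimalIntervention [NeZero n] {A U : Matrix (Fin n) (Fin n) ℝ}
    {d : Fin n → ℝ} {β : ℝ} (hU : Uᵀ * U = 1) (hU' : U * Uᵀ = 1)
    (hA : A = U * diagonal d * Uᵀ) (hd : ∀ i, β * d i < 1) (b : EuclideanSpace ℝ (Fin n)) (C : ℝ) :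
    ∃ y, IsOptimalIntervention A β b C y := by
  have hcont : Continuous (welfare A β b) := by
    rw [funext (welfare_conj_diagonal hU hU' hA hd b)]
    have : Continuous fun y : EuclideanSpace ℝ (Fin n) => Uᵀ *ᵥ (b + y).ofLp :=
      Continuous.matrix_mulVec continuous_const (by fun_prop)
    fun_prop
  obtain ⟨y, hy, hmax⟩ := (isCompact_sphere (0 : EuclideanSpace ℝ (Fin n)) (√C)
    ).exists_isMaxOn (NormedSpace.sphere_nonempty.2 (Real.sqrt_nonneg C)) hcont.continuousOn
  exact ⟨y, by simpa using hy, fun x hx => hmax (by simpa using hx)⟩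

/-- The optimum is bounded by giving every coordinate the top weight `l ^ 2`; the welfare of `√C •
v` is bounded below by its `k`-th coordinate alone. The absolute value in `hv` is needed since
eigenvectors have no preferred sign. -/
theorem competitiveRatioAtLeast_of_correlation [NeZero n] {A U : Matrix (Fin n) (Fin n) ℝ}
    {d : Fin n → ℝ} {β : ℝ} (hβ : 0 < β) (hU : Uᵀ * U = 1) (hU' : U * Uᵀ = 1)
    (hA : A = U * diagonal d * Uᵀ) (hd : ∀ i, β * d i < 1) {k : Fin n} (hk : ∀ i, d i ≤ d k)
    (b : EuclideanSpace ℝ (Fin n)) {v : EuclideanSpace ℝ (Fin n)} {ε C : ℝ} (hε : 0 < ε)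
    (hε1 : ε < 1) (hv1 : ‖v‖ = 1) (hv : 1 - ε / 8 ≤ |(Uᵀ *ᵥ v.ofLp) k|) (hC : 0 < C) (hCb : 16 * ‖b‖ / ε ≤ √C) :
    CompetitiveRatioAtLeast A β b C (√C • v) (1 - ε) := by
  obtain ⟨y, hy⟩ := exists_isOptimalIntervention hU hU' hA hd b C
  refine ⟨y, hy, ?_⟩
  have hr : 0 < √C := Real.sqrt_pos.2 hC
  have hnorm : ∀ z : EuclideanSpace ℝ (Fin n), ∑ i, (Uᵀ *ᵥ z.ofLp) i ^ 2 = ‖z‖ ^ 2 := by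
    intro z
    rw [EuclideanSpace.real_norm_sq_eq]
    have := transpose_mulVec_dotProduct hU' z.ofLp z.ofLp
    simpa only [dotProduct, ← pow_two] using this
  have hcoord : ∀ z : EuclideanSpace ℝ (Fin n), |(Uᵀ *ᵥ z.ofLp) k| ≤ ‖z‖ := by
    intro z
    rw [← abs_of_nonneg (norm_nonneg z), ← sq_le_sq, ← hnorm z]
    exact Finset.single_le_sum (f := fun i => (Uᵀ *ᵥ z.ofLp) i ^ 2) (fun i _ => sq_nonneg _)
      (Finset.mem_univ k)
  set l := (1 - β * d k)⁻¹ with hl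
  have hl0 : 0 < l := inv_pos.2 (sub_pos.2 (hd k))
  have hupper : welfare A β b y ≤ 1 / 2 * (l * (‖b‖ + √C)) ^ 2 := by
    rw [welfare_conj_diagonal hU hU' hA hd]
    refine mul_le_mul_of_nonneg_left ?_ (by norm_num)
    calc _ ≤ ∑ i, l ^ 2 * (Uᵀ *ᵥ (b + y).ofLp) i ^ 2 := by
          refine Finset.sum_le_sum fun i _ => mul_le_mul_of_nonneg_right ?_ (sq_nonneg _)
          have h1 : (1 - β * d i)⁻¹ ≤ l := by
            refine inv_anti₀ (sub_pos.2 (hd k)) ?_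
            have := mul_le_mul_of_nonneg_left (hk i) hβ.le
            linarith
          exact pow_le_pow_left₀ (inv_pos.2 (sub_pos.2 (hd i))).le h1 2
      _ = l ^ 2 * ‖b + y‖ ^ 2 := by rw [← Finset.mul_sum, hnorm]
      _ ≤ _ := by
          rw [mul_pow]
          gcongr
          exact (norm_add_le b y).trans_eq (by rw [hy.norm_eq])
  have hlower : 1 / 2 * (l * (√C * (1 - ε / 8) - ‖b‖)) ^ 2 ≤ welfare A β b (√C • v) := by
    rw [welfare_conj_diagonal hU hU' hA hd]
    refine mul_le_mul_of_nonneg_left ?_ (by norm_num)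
    refine le_trans ?_ (Finset.single_le_sum (fun i _ => by positivity) (Finset.mem_univ k))
    rw [mul_pow, ← hl]
    refine mul_le_mul_of_nonneg_left ?_ (sq_nonneg _)
    have hb := hcoord b
    have h1 : (Uᵀ *ᵥ (b + √C • v).ofLp) k = (Uᵀ *ᵥ b.ofLp) k + √C * (Uᵀ *ᵥ v.ofLp) k := by
      simp [mulVec_add, mulVec_smul]
    have h2 : √C * (1 - ε / 8) ≤ |√C * (Uᵀ *ᵥ v.ofLp) k| := by
      rw [abs_mul, abs_of_pos hr]
      exact mul_le_mul_of_nonneg_left hv hr.le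
    have h3 := abs_sub_abs_le_abs_sub (√C * (Uᵀ *ᵥ v.ofLp) k) (-(Uᵀ *ᵥ b.ofLp) k)
    rw [abs_neg, sub_neg_eq_add, add_comm (√C * _), ← h1] at h3
    have h4 : 0 ≤ √C * (1 - ε / 8) - ‖b‖ := by
      rw [div_le_iff₀ hε] at hCb
      nlinarith [norm_nonneg b]
    rw [← sq_abs ((Uᵀ *ᵥ (b + √C • v).ofLp) k)]
    exact pow_le_pow_left₀ h4 (by linarith) 2
  -- The difference of the two sides is `√C ε / 8 - (2 - ε / 4) ‖b‖`; this is where the 16 in `hCb`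
  -- comes from.
  have hq : (1 - ε / 4) * (‖b‖ + √C) ≤ √C * (1 - ε / 8) - ‖b‖ := by
    rw [div_le_iff₀ hε] at hCb
    nlinarith [norm_nonneg b]
  have hpos : 0 < (1 - ε / 4) * (‖b‖ + √C) := by
    have := norm_nonneg b
    have : 0 < 1 - ε / 4 := by linarith
    positivity
  have hsq : (1 - ε / 4) ^ 2 * (1 / 2 * (l * (‖b‖ + √C)) ^ 2) ≤ welfare A β b (√C • v) := by
    refine le_trans ?_ hlower
    have := mul_le_mul_of_nonneg_left (pow_le_pow_left₀ hpos.le hq 2) (sq_nonneg l)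
    nlinarith
  have hl2 : 0 < 1 / 2 * (l * (‖b‖ + √C)) ^ 2 := by
    have := norm_nonneg b
    positivity
  have hy0 : 0 < welfare A β b y := by
    refine lt_of_lt_of_le (mul_pos (pow_pos ?_ 2) hl2) (hsq.trans (hy.le_welfare _ ?_))
    · linarith
    · rw [norm_smul, hv1, mul_one, Real.norm_of_nonneg hr.le]
  rw [le_div_iff₀ hy0]
  refine le_trans ?_ hsq
  exact mul_le_mul (by nlinarith) hupper hy0.le (sq_nonneg _)

end Welfare

/-! ### Ordered eigenvalues and the inverted spectral gap. -/

section Concentration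

variable {n : ℕ} [NeZero n] {A : Matrix (Fin n) (Fin n) ℝ}

theorem invertedSpectralGap_nonneg (hA : A.IsSymm) : 0 ≤ invertedSpectralGap A hA :=
  Real.sInf_nonneg fun _ h => h.1

theorem abs_eigenvalue_le_invertedSpectralGap_mul (hA : A.IsSymm) (h0 : 0 < eigenvalue A hA 0)
    {i : Fin n} (hi : i ≠ 0) :
    |eigenvalue A hA i| ≤ invertedSpectralGap A hA * eigenvalue A hA 0 := by
  rw [← div_le_iff₀ h0]
  -- The sum of all ratios is a crude admissible `κ`: the set is nonempty, so its infimum is not a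
  -- default value.
  refine le_csInf ⟨∑ j, |eigenvalue A hA j| / eigenvalue A hA 0,
    Finset.sum_nonneg fun j _ => by positivity, fun j _ => ?_⟩ fun κ hκ => ?_
  · rw [← div_le_iff₀ h0]
    exact Finset.single_le_sum (f := fun j => |eigenvalue A hA j| / eigenvalue A hA 0)
      (fun j _ => by positivity) (Finset.mem_univ j)
  · rw [div_le_iff₀ h0]
    exact hκ.2 i hi

theorem eigenvalue_le_eigenvalue_zero (hA : A.IsSymm) (i : Fin n) :
    eigenvalue A hA i ≤ eigenvalue A hA 0 :=
  (isHermitian_of_isSymm hA).eigenvalues₀_antitone (Fin.zero_le i)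

omit [NeZero n] in
/-- The reindexing between `eigenvalue` and the eigenvalues of Mathlib. -/
theorem exists_equiv_eigenvalues (hA : A.IsSymm) : ∃ σ : Fin n ≃ Fin n, ∀ i,
    (isHermitian_of_isSymm hA).eigenvalues (σ i) = eigenvalue A hA i := by
  refine ⟨(finCongr (Fintype.card_fin n).symm).trans
    (Fintype.equivOfCardEq (Fintype.card_fin _)), fun i => ?_⟩
  simp only [Matrix.IsHermitian.eigenvalues, Equiv.trans_apply, Equiv.symm_apply_apply]
  rfl

/-- The trace is nonnegative, so the eigenvalues cannot all be negative. -/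
theorem eigenvalue_zero_nonneg (hA : A.IsSymm) (h0 : ∀ i j, 0 ≤ A i j) :
    0 ≤ eigenvalue A hA 0 := by
  have htr : 0 ≤ A.trace := Finset.sum_nonneg fun i _ => h0 i i
  obtain ⟨σ, hσ⟩ := exists_equiv_eigenvalues hA
  rw [(isHermitian_of_isSymm hA).trace_eq_sum_eigenvalues, ← Equiv.sum_comp σ] at htr
  simp only [hσ] at htr
  by_contra! hneg
  have : ∑ i, eigenvalue A hA i < 0 := Finset.sum_neg
    (fun i _ => (eigenvalue_le_eigenvalue_zero hA i).trans_lt hneg) Finset.univ_nonempty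
  exact absurd htr (not_le.2 this)

theorem quadratic_form_le_of_invertedSpectralGap_le (hA : A.IsSymm) {κ : ℝ} (h0 : 0 < eigenvalue A hA 0)
    (hκ : invertedSpectralGap A hA ≤ κ) (hκ1 : κ < 1) {v : EuclideanSpace ℝ (Fin n)}
    (hv : IsFirstEigenvector A hA v) {x : Fin n → ℝ} (hx : x ⬝ᵥ x = 1) :
    x ⬝ᵥ A *ᵥ x ≤ κ * eigenvalue A hA 0 +
      (eigenvalue A hA 0 - κ * eigenvalue A hA 0) * (v.ofLp ⬝ᵥ x) ^ 2 := by
  obtain ⟨U, hU, hU', hAU⟩ := exists_conj_diagonal_eigenvalues (isHermitian_of_isSymm hA)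
  obtain ⟨σ, hσ⟩ := exists_equiv_eigenvalues hA
  have h := dotProduct_mulVec_le_of_gap hU hU' (k := σ 0) (ν := κ * eigenvalue A hA 0)
    (v := v.ofLp) (x := x) (d := (isHermitian_of_isSymm hA).eigenvalues) ?_ ?_ ?_ ?_ hx
  · rwa [← hAU, hσ] at h
  · rw [hσ]
    exact mul_lt_of_lt_one_left h0 hκ1
  · intro i hi
    obtain ⟨j, rfl⟩ := σ.surjective i
    rw [hσ]
    refine (le_abs_self _).trans ((abs_eigenvalue_le_invertedSpectralGap_mul hA h0
      fun hj => hi (by rw [hj])).trans ?_)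
    exact mul_le_mul_of_nonneg_right hκ h0.le
  · have := EuclideanSpace.real_norm_sq_eq v
    rw [hv.norm_eq_one, one_pow] at this
    rw [dotProduct, this]
    simp only [pow_two]
  · rw [← hAU, hσ]
    exact hv.mulVec_eq

omit [NeZero n] in
theorem mul_eigenvalues_lt_one {B : Matrix (Fin n) (Fin n) ℝ} (hB : B.IsHermitian)
    {β : ℝ} (hβ : 0 < β) (h : spectralRadius ℝ B < ENNReal.ofReal (1 / β)) (i : Fin n) :
    β * hB.eigenvalues i < 1 := by
  have h1 : (‖hB.eigenvalues i‖₊ : ENNReal) ≤ spectralRadius ℝ B :=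
    le_iSup₂ (α := ENNReal) (f := fun k _ => (‖k‖₊ : ENNReal)) _
      (hB.eigenvalues_mem_spectrum_real i)
  have h2 := h1.trans_lt h
  rw [← enorm_eq_nnnorm, ← ofReal_norm, ENNReal.ofReal_lt_ofReal_iff (by positivity),
    Real.norm_eq_abs, lt_div_iff₀ hβ] at h2
  nlinarith [le_abs_self (hB.eigenvalues i)]

end Concentration

end NetworkGame

end

/-! ### The main theorem: choice of constants. -/

theorem mainTheorem1 {n : ℕ} [NeZero n]
    (Abar : Matrix (Fin n) (Fin n) ℝ) (hAbar : NetworkGame.IsEdgeProbMatrix Abar)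
    (ε δ : ℝ) (hconc : NetworkGame.Concentration Abar hAbar.symm ε δ)
    (v : EuclideanSpace ℝ (Fin n)) (hv : NetworkGame.IsFirstEigenvector Abar hAbar.symm v)
    (β : ℝ) (hβ : 0 < β) (b : EuclideanSpace ℝ (Fin n)) (hb : ∀ i, 0 ≤ b i) :
    ∃ C₀ : ℝ, ∀ {Ω : Type*} [MeasurableSpace Ω] (P : Measure Ω) [IsProbabilityMeasure P]
      (A : Ω → Matrix (Fin n) (Fin n) ℝ), NetworkGame.IsSampledFrom P A Abar →
      1 - δ ≤ P.real {ω | spectralRadius ℝ (A ω) < ENNReal.ofReal (1 / β) →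
        ∀ C : ℝ, C₀ ≤ C →
          NetworkGame.CompetitiveRatioAtLeast (A ω) β b C (√C • v) (1 - ε)} := by
  open NetworkGame in
  obtain ⟨hε, hε1, hδ, hδ1, hd, κ, hgap, hκ⟩ := hconc
  -- The `+ 1` keeps `C` positive when `b = 0`.
  refine ⟨(16 * ‖b‖ / ε) ^ 2 + 1, fun P _ A hA => ?_⟩
  have hn : (1 : ℝ) ≤ n := by exact_mod_cast NeZero.one_le
  set L := Real.log (2 * n / δ) with hL
  set D := dMax Abar
  set μ := eigenvalue Abar hAbar.symm 0
  have hLpos : 0 < L := Real.log_pos (by rw [lt_div_iff₀ hδ]; linarith)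
  have hDpos : 0 < D := by linarith
  have hexp : 2 * n * Real.exp (-L) = δ := by
    rw [hL, Real.exp_neg, Real.exp_log (by positivity)]
    field_simp
  -- The minimizer `√(L / D)` of `(L + s² D) / s` may exceed 1, up to `3/2` under the degree
  -- condition. Half of it is admissible and raises the constant only from 2 to `5/2`.
  set s := √(L / D) / 2 with hs
  have hs0 : 0 < s := by positivity
  have hs1 : s ≤ 1 := by
    have : √(L / D) ≤ 2 := by
      rw [Real.sqrt_le_left (by norm_num), div_le_iff₀ hDpos]
      linarith
    linarith
  have hM : (L + s ^ 2 * D) / s = 5 / 2 * √(D * L) := by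
    have h1 : s ^ 2 * D = L / 4 := by
      rw [hs, div_pow, Real.sq_sqrt (by positivity)]
      field_simp
      norm_num
    have h2 : s * √(D * L) = L / 2 := by
      rw [hs, div_mul_eq_mul_div, ← Real.sqrt_mul (by positivity)]
      congr 1
      rw [show L / D * (D * L) = L ^ 2 by field_simp, Real.sqrt_sq hLpos.le]
    rw [div_eq_iff hs0.ne', h1]
    linarith
  have hprob := one_sub_le_measureReal_quadratic_form hA hAbar hs0 hs1 L
  rw [hexp, hM] at hprob
  refine hprob.trans (measureReal_mono fun ω hω hrad C hC => ?_)
  have hT : 0 < √(D * L) := by positivity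
  have hμκ : 0 < μ * (1 - κ ^ 2) := lt_of_lt_of_le (by positivity) hκ
  have hμ0 : 0 ≤ μ := eigenvalue_zero_nonneg hAbar.symm hAbar.nonneg
  have hμ : 0 < μ := hμ0.lt_of_ne fun h => by rw [← h, zero_mul] at hμκ; exact hμκ.false
  have hκ0 : 0 ≤ κ := (invertedSpectralGap_nonneg hAbar.symm).trans hgap
  have hκ1 : κ < 1 := by
    have := pos_of_mul_pos_right hμκ hμ0
    nlinarith
  have hH := isHermitian_of_isSymm (hA.symm ω)
  obtain ⟨U, hU, hU', hAU⟩ := exists_conj_diagonal_eigenvalues hH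
  obtain ⟨k, hk⟩ := Finite.exists_max hH.eigenvalues
  have hvv : v.ofLp ⬝ᵥ v.ofLp = 1 := by
    have := EuclideanSpace.real_norm_sq_eq v
    rw [hv.norm_eq_one, one_pow] at this
    rw [dotProduct, this]
    simp only [pow_two]
  have hdk := gap_mul_one_sub_sq_le hU hU' hAU hk hvv hv.mulVec_eq
    (fun x hx => quadratic_form_le_of_invertedSpectralGap_le hAbar.symm hμ hgap hκ1 hv hx) hω
  set c := (Uᵀ *ᵥ v.ofLp) k
  have hcorr : 1 - ε / 8 ≤ |c| := by
    rw [div_le_iff₀ (by positivity)] at hκ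
    have h1 : μ * (1 - κ ^ 2) ≤ 2 * (μ - κ * μ) := by nlinarith
    -- Otherwise `c² < 1 - ε / 8`, and the perturbation bound gives `(μ - κ μ) ε / 8 ≤ 5 √(D L)`.
    -- The concentration hypothesis makes the left side at least `64 √(D L) / ε`, a contradiction.
    by_contra! hc
    have hc2 : c ^ 2 < (1 - ε / 8) := by
      rw [← sq_abs]
      nlinarith [abs_nonneg c]
    have h2 : (μ - κ * μ) * (ε / 8) ≤ 5 * √(D * L) := by
      have : 0 < μ - κ * μ := by linarith
      nlinarith
    have h3 : 1024 * √(D * L) ≤ 2 * (μ - κ * μ) * ε ^ 2 :=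
      hκ.trans (mul_le_mul_of_nonneg_right h1 (sq_nonneg ε))
    nlinarith [mul_le_mul_of_nonneg_right h2 hε.le]
  have hC0 : 0 < C := by nlinarith [sq_nonneg (16 * ‖b‖ / ε)]
  refine competitiveRatioAtLeast_of_correlation hβ hU hU' hAU
    (mul_eigenvalues_lt_one hH hβ hrad) hk b hε hε1 hv.norm_eq_one hcorr hC0 ?_
  exact Real.le_sqrt_of_sq_le (by linarith)
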